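/- A cactus is a finite simple graph in which any two distinct cycles have at most one common vertex. For a finite simple graph $G$, let $t(G)$ be the number of vertices of $G$ of degree at least $3$, and let $\rho(G)$, the spectral radius of $G$, be the largest eigenvalue of its adjacency matrix. A connected cactus of order $n$ (that is, with $n$ vertices) is said to have the maximal number of edges if no connected cactus of order $n$ has more edges. Let $G$ be a connected cactus of order $n$ with the maximal number of edges such that $t(G)>1$. Then there exists a connected cactus $G_1$ of order $n$ with the maximal number of edges such that $t(G_1)=t(G)-1$ and $\rho(G_1)>\rho(G)$. -/

import Mathlib

namespace SimpleGraph

/-- A graph is a cactus if any two different cycles have at most one common vertex.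
A cycle is regarded as a subgraph (so changing the starting point or the direction of the closed
walk gives the same cycle). Connectedness is not part of the definition. -/
def IsCactus {V : Type*} (G : SimpleGraph V) : Prop :=
  ∀ ⦃u v : V⦄ (p : G.Walk u u) (q : G.Walk v v), p.IsCycle → q.IsCycle →
    p.toSubgraph ≠ q.toSubgraph → (p.toSubgraph.verts ∩ q.toSubgraph.verts).Subsingleton

/-- `G` is a connected cactus which has the largest number of edges among all connected cacti
of the same order. -/
structure IsMaxConnectedCactus {V : Type*} (G : SimpleGraph V) : Prop where
  connected : G.Connected
  isCactus : G.IsCactus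
  card_edges_le : ∀ H : SimpleGraph V, H.Connected → H.IsCactus →
    H.edgeSet.ncard ≤ G.edgeSet.ncard

/-- The number `t(G)` of vertices of degree at least `3` (for a finite graph). -/
noncomputable def numDegGeThree {V : Type*} (G : SimpleGraph V) : ℕ :=
  {v : V | 3 ≤ (G.neighborSet v).ncard}.ncard

open Classical in
/-- The spectral radius (index) of a finite graph: the largest eigenvalue of its real
adjacency matrix. -/
noncomputable def largestAdjEigenvalue {V : Type*} [Fintype V] (G : SimpleGraph V) : ℝ :=
  sSup {μ : ℝ | Module.End.HasEigenvalue (G.adjMatrix ℝ).mulVecLin μ}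

end SimpleGraph

/-! Let `u`, `v` have degree at least 3, with Perron weights `x v ≤ x u`. In a cactus at most two
edges join `v` to any component of `G - v`, since three would give two cycles sharing `v` and
another vertex. So some edges at `v` lead to components without `u`; let all of these end at `u`
instead. The branches are only rehung, so the graph stays a connected cactus with as many edges,
hence still maximal. Now `v` has degree at most 2, `u` gains degree and no other degree changes, so
`t` drops by exactly one. The quadratic form at `x` does not decrease. If the spectral radius did
not grow, `x` would be an eigenvector of the new graph too, but its equation at `u` has gained
positive terms. -/

/-! ### Rayleigh quotients and the Perron vector -/

open Matrix in
theorem Matrix.IsHermitian.exists_hasEigenvalue {n : Type*} [Fintype n] [Nonempty n]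
    {A : Matrix n n ℝ} (hA : A.IsHermitian) :
    {μ : ℝ | Module.End.HasEigenvalue A.mulVecLin μ}.Nonempty := by
  classical
  obtain ⟨i⟩ := ‹Nonempty n›
  refine ⟨hA.eigenvalues i, Module.End.hasEigenvalue_of_hasEigenvector
    (x := (hA.eigenvectorBasis i).ofLp) ⟨?_, ?_⟩⟩
  · rw [Module.End.mem_eigenspace_iff]
    simpa using hA.mulVec_eigenvectorBasis i
  · intro h
    exact hA.eigenvectorBasis.orthonormal.ne_zero i (by ext j; exact congrFun h j)

theorem Matrix.finite_setOf_hasEigenvalue {n : Type*} [Fintype n] (A : Matrix n n ℝ) :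
    {μ : ℝ | Module.End.HasEigenvalue A.mulVecLin μ}.Finite :=
  Module.End.finite_hasEigenvalue _

open Matrix in
/-- Shifting a symmetric matrix by an upper bound of its eigenvalues. -/
theorem Matrix.IsHermitian.posSemidef_smul_one_sub {n : Type*} [Fintype n] [DecidableEq n]
    {A : Matrix n n ℝ} (hA : A.IsHermitian) {r : ℝ}
    (hr : ∀ μ, Module.End.HasEigenvalue A.mulVecLin μ → μ ≤ r) :
    (r • (1 : Matrix n n ℝ) - A).PosSemidef := by
  have hB : (r • (1 : Matrix n n ℝ) - A).IsHermitian :=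
    (Matrix.isHermitian_one.smul (IsSelfAdjoint.all r)).sub hA
  rw [hB.posSemidef_iff_eigenvalues_nonneg]
  intro i
  have h := hB.mulVec_eigenvectorBasis i
  have : r - hB.eigenvalues i ≤ r := by
    refine hr _ (Module.End.hasEigenvalue_of_hasEigenvector
      (x := (hB.eigenvectorBasis i).ofLp) ⟨?_, ?_⟩)
    · rw [Module.End.mem_eigenspace_iff]
      rw [sub_mulVec, smul_mulVec, one_mulVec] at h
      rw [mulVecLin_apply, sub_smul, ← h]
      abel
    · intro h
      exact hB.eigenvectorBasis.orthonormal.ne_zero i (by ext j; exact congrFun h j)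
  simpa using this

open Matrix in
/-- A vector whose Rayleigh quotient is at least an upper bound of the eigenvalues is an
eigenvector. -/
theorem Matrix.IsHermitian.mulVec_eq_smul_of_le {n : Type*} [Fintype n]
    {A : Matrix n n ℝ} (hA : A.IsHermitian) {r : ℝ}
    (hr : ∀ μ, Module.End.HasEigenvalue A.mulVecLin μ → μ ≤ r) {x : n → ℝ}
    (hx : r * (x ⬝ᵥ x) ≤ x ⬝ᵥ (A *ᵥ x)) : A *ᵥ x = r • x := by
  classical
  have hP := hA.posSemidef_smul_one_sub hr
  have h0 := hP.dotProduct_mulVec_nonneg x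
  -- A positive semidefinite form vanishes only on the kernel of its matrix.
  have h1 := (hP.dotProduct_mulVec_zero_iff x).1 (by
    refine le_antisymm ?_ h0
    simp only [star_trivial, sub_mulVec, smul_mulVec, one_mulVec, dotProduct_sub,
      dotProduct_smul, smul_eq_mul]
    linarith)
  rw [sub_mulVec, smul_mulVec, one_mulVec, sub_eq_zero] at h1
  exact h1.symm

namespace SimpleGraph

open Matrix

variable {V : Type*} [Fintype V]

open Classical in
theorem hasEigenvalue_le_largestAdjEigenvalue (G : SimpleGraph V) (μ : ℝ)
    (hμ : Module.End.HasEigenvalue (G.adjMatrix ℝ).mulVecLin μ) :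
    μ ≤ G.largestAdjEigenvalue :=
  le_csSup (Matrix.finite_setOf_hasEigenvalue _).bddAbove hμ

open Classical in
theorem hasEigenvalue_largestAdjEigenvalue [Nonempty V] (G : SimpleGraph V) :
    Module.End.HasEigenvalue (G.adjMatrix ℝ).mulVecLin G.largestAdjEigenvalue :=
  (isHermitian_adjMatrix (R := ℝ) (G := G)).exists_hasEigenvalue.csSup_mem
    (Matrix.finite_setOf_hasEigenvalue _)

open Classical in
theorem adjMatrix_mulVec_eq_of_le (G : SimpleGraph V) {x : V → ℝ}
    (hx : G.largestAdjEigenvalue * (x ⬝ᵥ x) ≤ x ⬝ᵥ (G.adjMatrix ℝ *ᵥ x)) :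
    G.adjMatrix ℝ *ᵥ x = G.largestAdjEigenvalue • x :=
  (isHermitian_adjMatrix (R := ℝ) (G := G)).mulVec_eq_smul_of_le
    G.hasEigenvalue_le_largestAdjEigenvalue hx

open Classical in
/-- A connected graph has a positive eigenvector for its largest eigenvalue. -/
theorem Connected.exists_pos_eigenvector {G : SimpleGraph V} (hG : G.Connected) :
    ∃ x : V → ℝ, (∀ v, 0 < x v) ∧ G.adjMatrix ℝ *ᵥ x = G.largestAdjEigenvalue • x := by
  have := hG.nonempty
  obtain ⟨y, hy⟩ := G.hasEigenvalue_largestAdjEigenvalue.exists_hasEigenvector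
  have hy1 : G.adjMatrix ℝ *ᵥ y = G.largestAdjEigenvalue • y := hy.apply_eq_smul
  have hx : G.adjMatrix ℝ *ᵥ (fun v => |y v|) = G.largestAdjEigenvalue • (fun v => |y v|) := by
    apply G.adjMatrix_mulVec_eq_of_le
    have h1 : (fun v => |y v|) ⬝ᵥ (fun v => |y v|) = y ⬝ᵥ y := by
      simp [dotProduct, abs_mul_abs_self]
    rw [h1, ← smul_eq_mul, ← dotProduct_smul, ← hy1]
    simp only [dotProduct, adjMatrix_mulVec_apply, Finset.mul_sum]
    refine Finset.sum_le_sum fun i _ => Finset.sum_le_sum fun j _ => ?_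
    rw [← abs_mul]
    exact le_abs_self _
  refine ⟨fun v => |y v|, ?_, hx⟩
  -- At a zero of `|y|` the eigenvalue equation is a vanishing sum of nonnegative terms, so zeros
  -- spread along edges.
  have hstep : ∀ a b, G.Adj a b → |y a| = 0 → |y b| = 0 := by
    intro a b hab ha
    have h := congrFun hx a
    simp only [adjMatrix_mulVec_apply, Pi.smul_apply, ha, smul_zero] at h
    exact (Finset.sum_eq_zero_iff_of_nonneg fun _ _ => abs_nonneg _).1 h b (by simpa using hab)
  by_contra! ⟨v, hv⟩
  refine hy.2 (funext fun w => abs_eq_zero.1 ?_)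
  obtain ⟨p⟩ := hG.preconnected v w
  induction p with
  | nil => exact le_antisymm hv (abs_nonneg _)
  | cons h p ih => exact ih (hstep _ _ h (le_antisymm hv (abs_nonneg _))).le

end SimpleGraph
-- Moving edges: spectrum and degrees
namespace SimpleGraph

open Matrix

/-- The graph obtained from `G` by replacing, for each `w ∈ S`, the edge from `v` to `w` by an edge
from `u` to `w`. -/
def shiftNeighbors {V : Type*} (G : SimpleGraph V) (u v : V) (S : Set V) : SimpleGraph V where
  Adj a b := a ≠ b ∧ (G.Adj a b ∧ ¬(a = v ∧ b ∈ S) ∧ ¬(b = v ∧ a ∈ S) ∨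
    a = u ∧ b ∈ S ∨ b = u ∧ a ∈ S)
  symm := ⟨fun a b h => by
    obtain ⟨hne, h | h | h⟩ := h
    · exact ⟨hne.symm, .inl ⟨h.1.symm, h.2.2, h.2.1⟩⟩
    · exact ⟨hne.symm, .inr (.inr h)⟩
    · exact ⟨hne.symm, .inr (.inl h)⟩⟩
  loopless := ⟨fun a h => h.1 rfl⟩

section Spectrum

variable {V : Type*} {G : SimpleGraph V} {u v : V} {S : Set V}

-- The hypotheses make every moved entry drop from 1 to 0 at `v` and rise from 0 to 1 at `u`. The
-- resulting low-rank update yields both the spectral comparison and the degrees.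
open Classical in
theorem adjMatrix_shiftNeighbors (huv : u ≠ v) (huS : u ∉ S) (hSv : ∀ w ∈ S, G.Adj v w)
    (hSu : ∀ w ∈ S, ¬ G.Adj u w) :
    (G.shiftNeighbors u v S).adjMatrix ℝ = G.adjMatrix ℝ +
      vecMulVec (Pi.single u 1 - Pi.single v 1) (S.indicator 1) +
      vecMulVec (S.indicator 1) (Pi.single u 1 - Pi.single v 1) := by
  have hvS : v ∉ S := fun h => G.loopless.irrefl v (hSv v h)
  ext a b
  simp only [adjMatrix_apply, Matrix.add_apply, vecMulVec_apply, Pi.sub_apply, Pi.single_apply,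
    Set.indicator_apply, Pi.one_apply, shiftNeighbors]
  have h1 := hSv a
  have h2 := hSv b
  have h3 := hSu a
  have h4 := hSu b
  have h5 := G.adj_comm a b
  by_cases hau : a = u
  · subst hau
    by_cases hbv : b = v
    · subst hbv; simp [huv, huv.symm, huS, hvS]
    · by_cases hb : b ∈ S
      · have : a ≠ b := fun h => huS (h ▸ hb)
        simp [huv, hbv, hb, this, huS, h4 hb]
      · by_cases hab : a = b <;> simp [huv, hb, hbv, huS, hab]
  · by_cases hav : a = v
    · subst hav
      by_cases hbu : b = u
      · subst hbu; simp [huv.symm, huS, hvS]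
      · by_cases hb : b ∈ S
        · simp [hau, hb, hbu, hvS, h2 hb]
        · by_cases hab : a = b <;> simp [hau, hb, hbu, hvS, hab]
    · by_cases hbu : b = u
      · subst hbu
        by_cases ha : a ∈ S
        · simp [hau, hav, ha, huS, huv, G.adj_comm a b, h3 ha]
        · simp [hau, hav, ha, huS, huv]
      · by_cases hbv : b = v
        · subst hbv
          by_cases ha : a ∈ S
          · simp [hau, hav, ha, hvS, hbu, (h1 ha).symm]
          · simp [hau, hav, ha, hvS, hbu]
        · by_cases hab : a = b
          · simp [hab, hbu, hbv]
          · simp [hau, hav, hbu, hbv, hab]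

variable [Fintype V]

open Classical in
theorem adjMatrix_shiftNeighbors_mulVec (huv : u ≠ v) (huS : u ∉ S) (hSv : ∀ w ∈ S, G.Adj v w)
    (hSu : ∀ w ∈ S, ¬ G.Adj u w) (x : V → ℝ) :
    (G.shiftNeighbors u v S).adjMatrix ℝ *ᵥ x = G.adjMatrix ℝ *ᵥ x +
      (S.indicator 1 ⬝ᵥ x) • (Pi.single u 1 - Pi.single v 1) +
      (x u - x v) • S.indicator 1 := by
  rw [adjMatrix_shiftNeighbors huv huS hSv hSu, add_mulVec, add_mulVec, vecMulVec_mulVec,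
    vecMulVec_mulVec, sub_dotProduct, single_one_dotProduct, single_one_dotProduct]
  ext
  simp [mul_comm]

/-- Shifting neighbors towards a vertex of larger weight in a Perron vector increases the
spectral radius. -/
theorem Connected.exists_weight_shiftNeighbors (hG : G.Connected) :
    ∃ x : V → ℝ, ∀ (u v : V) (S : Set V), x v ≤ x u → u ≠ v → u ∉ S → S.Nonempty →
      (∀ w ∈ S, G.Adj v w) → (∀ w ∈ S, ¬ G.Adj u w) →
      G.largestAdjEigenvalue < (G.shiftNeighbors u v S).largestAdjEigenvalue := by
  classical
  obtain ⟨x, hx, hGx⟩ := hG.exists_pos_eigenvector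
  refine ⟨x, fun u v S hvu huv huS hS hSv hSu => ?_⟩
  have key := adjMatrix_shiftNeighbors_mulVec huv huS hSv hSu x
  obtain ⟨w, hw⟩ := hS
  have hs : 0 < S.indicator 1 ⬝ᵥ x := by
    refine Finset.sum_pos' (fun i _ => mul_nonneg ?_ (hx i).le) ⟨w, Finset.mem_univ w, ?_⟩
    · exact Set.indicator_nonneg (fun _ _ => zero_le_one) _
    · simpa [hw] using hx w
  have hxx : 0 ≤ x ⬝ᵥ x := Finset.sum_nonneg fun i _ => mul_self_nonneg _
  by_contra! hle
  have hq : x ⬝ᵥ ((G.shiftNeighbors u v S).adjMatrix ℝ *ᵥ x) =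
      G.largestAdjEigenvalue * (x ⬝ᵥ x) + 2 * ((S.indicator 1 ⬝ᵥ x) * (x u - x v)) := by
    rw [key, hGx]
    simp only [dotProduct_add, dotProduct_smul, smul_eq_mul, dotProduct_sub,
      dotProduct_single_one]
    rw [dotProduct_comm x (S.indicator 1)]
    ring
  have hE := adjMatrix_mulVec_eq_of_le (G.shiftNeighbors u v S) (x := x) (by
    rw [hq]
    have := mul_le_mul_of_nonneg_right hle hxx
    have := mul_nonneg hs.le (sub_nonneg.2 hvu)
    linarith)
  -- Row `u` exceeds the old one by the weight of `S` plus nothing else, because `u ∉ S`.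
  have hu := congrFun (hE.symm.trans key) u
  simp [hGx, huv, huS] at hu
  have := mul_le_mul_of_nonneg_right hle (hx u).le
  linarith

-- Degrees are row sums, so the update formula is applied to the all-ones vector.
open Classical in
theorem ncard_neighborSet_shiftNeighbors (huv : u ≠ v) (huS : u ∉ S) (hSv : ∀ w ∈ S, G.Adj v w)
    (hSu : ∀ w ∈ S, ¬ G.Adj u w) (w : V) :
    (((G.shiftNeighbors u v S).neighborSet w).ncard : ℝ) = (G.neighborSet w).ncard +
      S.ncard * ((if w = u then 1 else 0) - (if w = v then 1 else 0)) := by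
  have h := congrFun (adjMatrix_shiftNeighbors_mulVec huv huS hSv hSu (Function.const V 1)) w
  simp only [adjMatrix_mulVec_const_apply, Pi.add_apply, Pi.smul_apply, Pi.sub_apply,
    Pi.single_apply, Function.const_apply, sub_self, zero_smul, mul_one,
    smul_eq_mul] at h
  have h2 : S.indicator (1 : V → ℝ) ⬝ᵥ Function.const V 1 = S.ncard := by
    simp [dotProduct, Set.indicator_apply, Set.ncard_eq_toFinset_card']
  rw [h2] at h
  simp_rw [← coe_neighborFinset, Set.ncard_coe_finset, card_neighborFinset_eq_degree]
  simpa using h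

theorem ncard_edgeSet_shiftNeighbors (huv : u ≠ v) (huS : u ∉ S) (hSv : ∀ w ∈ S, G.Adj v w)
    (hSu : ∀ w ∈ S, ¬ G.Adj u w) :
    (G.shiftNeighbors u v S).edgeSet.ncard = G.edgeSet.ncard := by
  classical
  have hsum : ∀ H : SimpleGraph V, ∑ w, ((H.neighborSet w).ncard : ℝ) = 2 * H.edgeSet.ncard := by
    intro H
    have := H.sum_degrees_eq_twice_card_edges
    rw [← coe_edgeFinset H, Set.ncard_coe_finset]
    simp_rw [← coe_neighborFinset, Set.ncard_coe_finset, card_neighborFinset_eq_degree]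
    exact_mod_cast this
  have h1 := hsum (G.shiftNeighbors u v S)
  simp_rw [ncard_neighborSet_shiftNeighbors huv huS hSv hSu, mul_sub, Finset.sum_add_distrib,
    Finset.sum_sub_distrib, hsum G] at h1
  simp at h1
  exact h1.symm

end Spectrum
end SimpleGraph
-- Cycles and connectedness under moving branches
namespace SimpleGraph

variable {V : Type*} {G : SimpleGraph V} {u v : V}

theorem Walk.mem_support_of_separates {D : Set V}
    (hD : ∀ a b, G.Adj a b → a ∈ D → b ∉ D → b = u) {a b : V} (p : G.Walk a b)
    (ha : a ∈ D) (hb : b ∉ D) : u ∈ p.support := by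
  induction p with
  | nil => exact absurd ha hb
  | @cons a c b h p ih =>
    by_cases hc : c ∈ D
    · simp [ih hc hb]
    · simp [← hD _ _ h ha hc]

/-- A cycle does not pass through a cut vertex to the other side. -/
theorem Walk.IsCycle.support_subset_or_disjoint {D : Set V} (hu : u ∉ D)
    (hD : ∀ a b, G.Adj a b → a ∈ D → b ∉ D → b = u) {w : V} {p : G.Walk w w} (hp : p.IsCycle) :
    (∀ x ∈ p.support, x ∈ D ∨ x = u) ∨ ∀ x ∈ p.support, x ∉ D := by
  classical
  by_contra! ⟨⟨b, hb, hbD, hbu⟩, a, ha, haD⟩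
  have hc := hp.rotate (hu := ha)
  have hb' : b ∈ (p.rotate a ha).support := (p.mem_support_rotate_iff a ha).2 hb
  generalize p.rotate a ha = c at hc hb'
  -- Both arcs of the cycle between `a` and `b` must pass through `u`, which differs from `a` and
  -- `b`, so `u` would be repeated.
  have h1 := (c.takeUntil b hb').mem_support_of_separates hD haD hbD
  have h2 := (c.dropUntil b hb').reverse.mem_support_of_separates hD haD hbD
  rw [Walk.support_reverse, List.mem_reverse] at h2
  have hnd := hc.support_nodup
  rw [← c.take_spec hb', Walk.tail_support_append, List.nodup_append'] at hnd
  refine hnd.2.2 ((Walk.mem_support_iff _).1 h1 |>.resolve_left ?_)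
    ((Walk.mem_support_iff _).1 h2 |>.resolve_left hbu.symm)
  rintro rfl
  exact hu haD

/-- Two cycles of a graph which a permutation maps into a cactus share at most one vertex. -/
theorem IsCactus.subsingleton_inter_of_map (hG : G.IsCactus) {H : SimpleGraph V}
    (σ : Equiv.Perm V) {a b : V} {p : H.Walk a a} {q : H.Walk b b} (hp : p.IsCycle)
    (hq : q.IsCycle) (hpG : ∀ x y, s(x, y) ∈ p.edges → G.Adj (σ x) (σ y))
    (hqG : ∀ x y, s(x, y) ∈ q.edges → G.Adj (σ x) (σ y)) (hne : p.toSubgraph ≠ q.toSubgraph) :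
    (p.toSubgraph.verts ∩ q.toSubgraph.verts).Subsingleton := by
  have hpe : ∀ e ∈ p.edges, e ∈ (G.comap σ).edgeSet := Sym2.ind hpG
  have hqe : ∀ e ∈ q.edges, e ∈ (G.comap σ).edgeSet := Sym2.ind hqG
  let f : G.comap σ →g G := ⟨σ, id⟩
  have hf : Function.Injective f := σ.injective
  have hS := hG ((p.transfer _ hpe).map f) ((q.transfer _ hqe).map f)
    ((hp.transfer hpe).map hf) ((hq.transfer hqe).map hf) (by
      intro h
      have hE : ∀ e, e ∈ p.edges ↔ e ∈ q.edges := by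
        intro e
        have := congrArg (fun K => Sym2.map f e ∈ K.edgeSet) h
        simpa only [Walk.mem_edges_toSubgraph, Walk.edges_map, Walk.edges_transfer,
          List.mem_map_of_injective (Sym2.map.injective hf), eq_iff_iff] using this
      have hV : ∀ x, x ∈ p.support ↔ x ∈ q.support := by
        intro x
        have := congrArg (fun K => f x ∈ K.verts) h
        simpa only [Walk.mem_verts_toSubgraph, Walk.support_map, Walk.support_transfer,
          List.mem_map_of_injective hf, eq_iff_iff] using this
      refine hne (Subgraph.ext ?_ ?_)
      · ext x
        simpa using hV x
      · ext x y
        simpa [Walk.adj_toSubgraph_iff_mem_edges] using hE s(x, y))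
  intro x hx y hy
  simp only [Set.mem_inter_iff, Walk.mem_verts_toSubgraph] at hx hy
  refine hf (hS ?_ ?_) <;>
    simp only [Set.mem_inter_iff, Walk.mem_verts_toSubgraph, Walk.support_map,
      Walk.support_transfer, List.mem_map_of_injective hf]
  exacts [hx, hy]

/-- A cycle of the new graph lies in `D ∪ {u}` or avoids `D`. Swapping `u` and `v` carries the first
kind into `G`, the identity the second; cycles of different kinds meet at most in `u`. -/
theorem IsCactus.shiftNeighbors (hG : G.IsCactus) {D : Set V} (huv : u ≠ v) (hu : u ∉ D)
    (hv : v ∉ D) (hD : ∀ a b, G.Adj a b → a ∈ D → b ∉ D → b = v) :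
    (G.shiftNeighbors u v {w | w ∈ D ∧ G.Adj v w}).IsCactus := by
  classical
  set H := G.shiftNeighbors u v {w | w ∈ D ∧ G.Adj v w}
  have hsep : ∀ a b, H.Adj a b → a ∈ D → b ∉ D → b = u := by
    rintro a b ⟨-, ⟨h, -, h'⟩ | ⟨rfl, h⟩ | ⟨rfl, h⟩⟩ ha hb
    · obtain rfl := hD a b h ha hb
      exact absurd ⟨rfl, ha, h.symm⟩ h'
    · exact absurd h.1 hb
    · rfl
  have hout : ∀ a b, H.Adj a b → a ∉ D → b ∉ D → G.Adj a b := by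
    rintro a b ⟨-, h | h | h⟩ ha hb
    exacts [h.1, absurd h.2.1 hb, absurd h.2.1 ha]
  have hσ : ∀ x ∈ D, Equiv.swap u v x = x := fun x hx =>
    Equiv.swap_apply_of_ne_of_ne (fun h => hu (h ▸ hx)) (fun h => hv (h ▸ hx))
  have hin : ∀ a b, H.Adj a b → (a ∈ D ∨ a = u) → (b ∈ D ∨ b = u) →
      G.Adj (Equiv.swap u v a) (Equiv.swap u v b) := by
    rintro a b hab (ha | rfl) (hb | rfl)
    · rw [hσ a ha, hσ b hb]
      obtain ⟨-, h | ⟨rfl, -⟩ | ⟨rfl, -⟩⟩ := hab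
      exacts [h.1, absurd ha hu, absurd hb hu]
    · rw [hσ a ha, Equiv.swap_apply_left]
      obtain ⟨-, h | ⟨rfl, -⟩ | h⟩ := hab
      exacts [absurd (hD a b h.1 ha hu) huv, absurd ha hu, h.2.2.symm]
    · rw [hσ b hb, Equiv.swap_apply_left]
      obtain ⟨-, h | h | ⟨rfl, -⟩⟩ := hab
      exacts [absurd (hD b a h.1.symm hb hu) huv, h.2.2, absurd hb hu]
    · exact absurd rfl hab.ne
  intro a b p q hp hq hne
  have hadj : ∀ {w : V} (r : H.Walk w w) {x y : V}, s(x, y) ∈ r.edges →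
      H.Adj x y ∧ x ∈ r.support ∧ y ∈ r.support := fun r _ _ h =>
    ⟨r.adj_of_mem_edges h, r.fst_mem_support_of_mem_edges h, r.snd_mem_support_of_mem_edges h⟩
  have hsub : ∀ {w z : V} (r : H.Walk w w) (s : H.Walk z z),
      (∀ x ∈ r.support, x ∈ D ∨ x = u) → (∀ x ∈ s.support, x ∉ D) →
      r.toSubgraph.verts ∩ s.toSubgraph.verts ⊆ {u} := by
    intro w z r s hr hs x hx
    simp only [Set.mem_inter_iff, Walk.mem_verts_toSubgraph] at hx
    exact (hr x hx.1).resolve_left (hs x hx.2)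
  rcases hp.support_subset_or_disjoint hu hsep with hpD | hpD <;>
    rcases hq.support_subset_or_disjoint hu hsep with hqD | hqD
  · refine hG.subsingleton_inter_of_map (Equiv.swap u v) hp hq (fun x y h => ?_)
      (fun x y h => ?_) hne
    · obtain ⟨h1, h2, h3⟩ := hadj p h
      exact hin x y h1 (hpD x h2) (hpD y h3)
    · obtain ⟨h1, h2, h3⟩ := hadj q h
      exact hin x y h1 (hqD x h2) (hqD y h3)
  · exact Set.subsingleton_singleton.anti (hsub p q hpD hqD)
  · rw [Set.inter_comm]
    exact Set.subsingleton_singleton.anti (hsub q p hqD hpD)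
  · refine hG.subsingleton_inter_of_map (Equiv.refl V) hp hq (fun x y h => ?_)
      (fun x y h => ?_) hne
    · obtain ⟨h1, h2, h3⟩ := hadj p h
      exact hout x y h1 (hpD x h2) (hpD y h3)
    · obtain ⟨h1, h2, h3⟩ := hadj q h
      exact hout x y h1 (hqD x h2) (hqD y h3)

theorem Reachable.exists_isPath_of_deleteIncidenceSet {a b : V}
    (h : (G.deleteIncidenceSet v).Reachable a b) (hav : a ≠ v) :
    ∃ p : G.Walk a b, p.IsPath ∧ v ∉ p.support := by
  classical
  obtain ⟨p, hp⟩ := h.exists_isPath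
  refine ⟨p.mapLe (G.deleteIncidenceSet_le v), hp.mapLe _, ?_⟩
  rw [Walk.support_mapLe_eq_support]
  clear hp h
  induction p with
  | nil => simpa using hav.symm
  | cons h p ih =>
    have h' := deleteIncidenceSet_adj.1 h
    simpa [hav.symm] using ih h'.2.2

/-- In a cactus, at most two edges lead from a vertex `v` to one component of `G - v`. -/
theorem IsCactus.ncard_adj_reachable_le_two (hG : G.IsCactus) (u v : V) :
    {w | G.Adj v w ∧ (G.deleteIncidenceSet v).Reachable u w}.ncard ≤ 2 := by
  by_contra! hlt
  obtain ⟨a, b, c, ⟨hva, hua⟩, ⟨hvb, hub⟩, ⟨hvc, huc⟩, hab, hac, hbc⟩ :=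
    (Set.two_lt_ncard_iff (Set.finite_of_ncard_pos (by omega))).1 hlt
  obtain ⟨p, hp, hvp⟩ := (hub.symm.trans hua).exists_isPath_of_deleteIncidenceSet hvb.ne'
  obtain ⟨q, hq, hvq⟩ := (huc.symm.trans hua).exists_isPath_of_deleteIncidenceSet hvc.ne'
  have hcyc : ∀ {x : V} (r : G.Walk x a) (hvx : G.Adj v x), x ≠ a → r.IsPath → v ∉ r.support →
      (Walk.cons hva.symm (Walk.cons hvx r)).IsCycle := by
    intro x r hvx hxa hr hvr
    rw [Walk.cons_isCycle_iff, Walk.cons_isPath_iff, Walk.edges_cons, List.mem_cons, not_or]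
    refine ⟨⟨hr, hvr⟩, ?_, fun h => hvr (r.snd_mem_support_of_mem_edges h)⟩
    simp [hva.ne', hxa.symm]
  -- Both cycles contain `v` and `a`; only the second uses the edge from `v` to `c`.
  have hS := hG _ _ (hcyc p hvb hab.symm hp hvp) (hcyc q hvc hac.symm hq hvq) (by
    intro h
    have := congrArg (fun K => s(v, c) ∈ K.edgeSet) h
    simp only [Walk.mem_edges_toSubgraph, Walk.edges_cons, List.mem_cons, eq_iff_iff] at this
    rcases this.2 (by simp) with h | h | h
    · simp [hva.ne, hac.symm] at h
    · simp [hbc.symm, hvb.ne] at h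
    · exact hvp (p.fst_mem_support_of_mem_edges h))
  exact hva.ne (hS (x := v) (y := a) (by simp) (by simp))

theorem Connected.exists_adj_reachable_deleteIncidenceSet (hG : G.Connected) (huv : u ≠ v) :
    ∃ w, G.Adj w v ∧ (G.deleteIncidenceSet v).Reachable u w := by
  obtain ⟨p⟩ := hG.preconnected u v
  suffices ∀ a b, G.Walk a b → a ≠ b →
      ∃ w, G.Adj w b ∧ (G.deleteIncidenceSet b).Reachable a w from this u v p huv
  intro a b p
  induction p with
  | nil => exact fun h => absurd rfl h
  | @cons a c b h p ih =>
    intro hab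
    by_cases hcb : c = b
    · exact ⟨a, hcb ▸ h, Reachable.refl a⟩
    · obtain ⟨w, hw, hcw⟩ := ih hcb
      exact ⟨w, hw, (deleteIncidenceSet_adj.2 ⟨h, hab, hcb⟩).reachable.trans hcw⟩

/-- A neighbour of `v` on the side of `u` is not moved, so `u` still reaches `v`, and each lost edge
from `v` to `w` is replaced by a detour through `u`. -/
theorem Connected.shiftNeighbors (hG : G.Connected) (huv : u ≠ v) {S : Set V} (hv : v ∉ S)
    (hS : ∀ w ∈ S, ¬ (G.deleteIncidenceSet v).Reachable u w) :
    (G.shiftNeighbors u v S).Connected := by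
  have huS : ∀ w ∈ S, (G.shiftNeighbors u v S).Reachable u w := fun w hw =>
    Adj.reachable (G := G.shiftNeighbors u v S)
      ⟨fun h => hS w hw (h ▸ Reachable.refl u), .inr (.inl ⟨rfl, hw⟩)⟩
  have hle : G.deleteIncidenceSet v ≤ G.shiftNeighbors u v S := by
    intro a b h
    obtain ⟨h, ha, hb⟩ := deleteIncidenceSet_adj.1 h
    exact ⟨h.ne, .inl ⟨h, fun h => ha h.1, fun h => hb h.1⟩⟩
  have hruv : (G.shiftNeighbors u v S).Reachable u v := by
    obtain ⟨w, hwv, huw⟩ := hG.exists_adj_reachable_deleteIncidenceSet huv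
    exact (huw.mono hle).trans (Adj.reachable (G := G.shiftNeighbors u v S)
      ⟨hwv.ne, .inl ⟨hwv, fun h => hv h.2, fun h => hS w h.2 huw⟩⟩)
  have hadj : ∀ a b, G.Adj a b → (G.shiftNeighbors u v S).Reachable a b := by
    intro a b h
    by_cases h1 : a = v ∧ b ∈ S
    · exact h1.1 ▸ hruv.symm.trans (huS b h1.2)
    by_cases h2 : b = v ∧ a ∈ S
    · exact (huS a h2.2).symm.trans (h2.1 ▸ hruv)
    exact Adj.reachable (G := G.shiftNeighbors u v S) ⟨h.ne, .inl ⟨h, h1, h2⟩⟩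
  have := hG.nonempty
  refine ⟨fun a b => ?_⟩
  obtain ⟨p⟩ := hG.preconnected a b
  induction p with
  | nil => exact Reachable.refl _
  | cons h p ih => exact (hadj _ _ h).trans ih

end SimpleGraph
-- Rehanging branches in a maximal cactus
namespace SimpleGraph

variable {V : Type*} [Fintype V] {G : SimpleGraph V} {u v : V}

/-- Moving all branches at `v` which do not contain `u` from `v` to `u`. -/
theorem IsMaxConnectedCactus.shiftNeighbors (hG : G.IsMaxConnectedCactus) (huv : u ≠ v)
    (hu : 3 ≤ (G.neighborSet u).ncard) (hv : 3 ≤ (G.neighborSet v).ncard) :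
    ∃ S : Set V, u ∉ S ∧ S.Nonempty ∧ (∀ w ∈ S, G.Adj v w) ∧ (∀ w ∈ S, ¬ G.Adj u w) ∧
      (G.shiftNeighbors u v S).IsMaxConnectedCactus ∧
      (G.shiftNeighbors u v S).numDegGeThree + 1 = G.numDegGeThree := by
  set D : Set V := {w | w ≠ v ∧ ¬ (G.deleteIncidenceSet v).Reachable u w}
  have huD : u ∉ D := fun h => h.2 (Reachable.refl u)
  have hvD : v ∉ D := fun h => h.1 rfl
  have hD : ∀ a b, G.Adj a b → a ∈ D → b ∉ D → b = v := by
    intro a b hab ha hb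
    by_contra hbv
    have hub : (G.deleteIncidenceSet v).Reachable u b := by
      by_contra h
      exact hb ⟨hbv, h⟩
    exact ha.2 (hub.trans (deleteIncidenceSet_adj.2 ⟨hab.symm, hbv, ha.1⟩).reachable)
  set S : Set V := {w | w ∈ D ∧ G.Adj v w}
  have huS : u ∉ S := fun h => huD h.1
  have hSv : ∀ w ∈ S, G.Adj v w := fun w h => h.2
  have hSu : ∀ w ∈ S, ¬ G.Adj u w := fun w h h' =>
    huv (hD w u h'.symm h.1 huD)
  have hdeg := ncard_neighborSet_shiftNeighbors huv huS hSv hSu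
  -- This bound gives both that `S` is nonempty and that `v` keeps at most two neighbours.
  have hcard : (G.neighborSet v).ncard ≤ 2 + S.ncard := by
    have hsub : G.neighborSet v ⊆
        {w | G.Adj v w ∧ (G.deleteIncidenceSet v).Reachable u w} ∪ S := by
      intro w hw
      by_cases h : (G.deleteIncidenceSet v).Reachable u w
      · exact .inl ⟨hw, h⟩
      · exact .inr ⟨⟨hw.ne', h⟩, hw⟩
    exact (Set.ncard_le_ncard hsub).trans ((Set.ncard_union_le _ _).trans
      (Nat.add_le_add_right (hG.isCactus.ncard_adj_reachable_le_two u v) _))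
  have hvd : ((G.shiftNeighbors u v S).neighborSet v).ncard + S.ncard =
      (G.neighborSet v).ncard := by
    have h := hdeg v
    rw [if_neg huv.symm, if_pos rfl] at h
    exact_mod_cast (by linarith :
      (((G.shiftNeighbors u v S).neighborSet v).ncard : ℝ) + S.ncard = (G.neighborSet v).ncard)
  have hud : ((G.shiftNeighbors u v S).neighborSet u).ncard =
      (G.neighborSet u).ncard + S.ncard := by
    have h := hdeg u
    rw [if_neg huv, if_pos rfl] at h
    exact_mod_cast (by linarith : (((G.shiftNeighbors u v S).neighborSet u).ncard : ℝ) =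
      (G.neighborSet u).ncard + S.ncard)
  refine ⟨S, huS, Set.nonempty_of_ncard_ne_zero (by omega), hSv, hSu, ⟨?_, ?_, ?_⟩, ?_⟩
  · exact hG.connected.shiftNeighbors huv (fun h => hvD h.1) fun w hw => hw.1.2
  · exact hG.isCactus.shiftNeighbors huv huD hvD hD
  · intro H hH hH'
    rw [ncard_edgeSet_shiftNeighbors huv huS hSv hSu]
    exact hG.card_edges_le H hH hH'
  · have hT : {w | 3 ≤ ((G.shiftNeighbors u v S).neighborSet w).ncard} =
        {w | 3 ≤ (G.neighborSet w).ncard} \ {v} := by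
      ext w
      simp only [Set.mem_ofPred_eq, Set.mem_sdiff, Set.mem_singleton_iff]
      by_cases hwv : w = v
      · subst hwv
        simp only [not_true, and_false, iff_false]
        omega
      · by_cases hwu : w = u
        · subst hwu
          simp only [hwv, not_false_eq_true, and_true]
          omega
        · have h := hdeg w
          rw [if_neg hwu, if_neg hwv, sub_zero, mul_zero, add_zero, Nat.cast_inj] at h
          simp [h, hwv]
    rw [numDegGeThree, hT]
    exact Set.ncard_sdiff_singleton_add_one hv

end SimpleGraph

theorem corollary2p6 {V : Type*} [Fintype V] (G : SimpleGraph V)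
    (hG : G.IsMaxConnectedCactus) (ht : 1 < G.numDegGeThree) :
    ∃ G₁ : SimpleGraph V, G₁.IsMaxConnectedCactus ∧
      G₁.numDegGeThree + 1 = G.numDegGeThree ∧
      G.largestAdjEigenvalue < G₁.largestAdjEigenvalue := by
  obtain ⟨x, hx⟩ := hG.connected.exists_weight_shiftNeighbors
  obtain ⟨a, b, ha, hb, hab⟩ := (Set.one_lt_ncard_iff (Set.toFinite _)).1 ht
  -- The weight `x` does not depend on the pair, so the heavier vertex may be called `a`.
  wlog hle : x b ≤ x a generalizing a b
  · exact this b a hb ha hab.symm (le_of_not_ge hle)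
  obtain ⟨S, haS, hS, hSb, hSa, hmax, hnum⟩ := hG.shiftNeighbors hab ha hb
  exact ⟨_, hmax, hnum, hx a b S hle hab haS hS hSb hSa⟩
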